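/- **Setting.** For $v>0$ let $\mathcal K(x,x')=\exp(-\|x-x'\|^2/(2v^2))$ on $\mathbb R^d$. Fix $c\in(0,1)$, $\lambda_0>0$, $B_y\ge 0$, $\kappa_{\min}\in(0,1]$ and $N\ge 1$. An admissible data set consists of $x_1,\dots,x_N,x_{N+1}\in\mathbb R^d$ and $y_1,\dots,y_N\in[-B_y,B_y]$ with $\mathcal K(x_i,x_j)\ge\kappa_{\min}$ for all $i,j\in\{1,\dots,N+1\}$. Put $\mathbf K=(\mathcal K(x_i,x_j))_{i,j\le N}$ and $\lambda=\lambda_0N$, and let $w^*\in\mathbb R^N$ be the (unique) solution of $(\mathbf K+\lambda \mathbf I)w^*=y$; the Gaussian-kernel ridge (Bayes) prediction at $x_{N+1}$ is $\sum_{i=1}^N w_i^*\mathcal K(x_i,x_{N+1})$. The prompt is the matrix $Z\in\mathbb R^{D\times(N+2)}$, $D=d+11$, with columns $z_i=(x_i,\,y_i,\,0,\,\|x_i\|^2,\,0,0,0,0,0,\,s_i,\,t_i,\,1)$, $i=0,\dots,N+1$, where $x_0=0$, $y_0=y_{N+1}=0$, $s_i=\mathbf 1[i=0]$, $t_i=\mathbf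 1[i=N+1]$. A single-head softmax transformer of MLP width $W$ is a composition of blocks, each of which is an attention layer $$z_i\mapsto z_i+\sum_{j=0}^{N+1}\frac{\exp(\langle W_Qz_i,W_Kz_j\rangle+M_{ij})}{\sum_{j'}\exp(\langle W_Qz_i,W_Kz_{j'}\rangle+M_{ij'})}\,W_Vz_j$$ with $W_Q,W_K,W_V\in\mathbb R^{D\times D}$ and a mask $M_{ij}\in\{0,-\infty\}$ (every row having a finite entry), followed by an MLP layer $z_i\mapsto z_i+W_{\mathrm{out}}\mathrm{ReLU}(W_{\mathrm{in}}z_i)$ with $W_{\mathrm{in}}\in\mathbb R^{W\times D}$, $W_{\mathrm{out}}\in\mathbb R^{D\times W}$. The readout of a $D\times(N+2)$ matrix is its entry in row $d+1$ (the label row) and in the last column. **Theorem.** Let $0<\eta\le \dfrac{2}{1+\lambda_0+\lambda_0/\kappa_{\min}}$ and $\varepsilon\in(0,c)$. There is a single-head softmax transformer $\mathrm{TF}$ with exactly $2L+5$ blocks and MLP width $W$, which does not depend on the data set, such that for every admissible data set $$\Bigl|\mathrm{readout}(\mathrm{TF}(Z))-\sum_{i=1}^N w_i^*\mathcal K(x_i,x_{N+1})\Bigr|\le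 C_{\mathrm{sys}}\,\varepsilon ,$$ where $$C_{\mathrm{sys}}=\frac{(\frac1{\sqrt{\lambda_0}}+1)B_y}{\lambda_0}\Bigl(\frac{2}{\sqrt{\kappa_{\min}}}+1\Bigr)+2\,\frac{\frac{B_y}{\sqrt{\lambda_0}}+2(1+\lambda_0)}{\lambda_0(1-c)\sqrt{\kappa_{\min}}}+\frac12,\qquad L=\Bigl\lceil\frac{\log(1/\varepsilon)}{\log\bigl(1/(1-\eta\lambda_0(1-c))\bigr)}\Bigr\rceil,$$ $$W=\max\{n_{\mathrm{flip}},\,2n_{\mathrm{sq}},\,2\widetilde n_{\mathrm{sq}}+4,\,n_{\mathrm{inv}},\,2\widehat n_{\mathrm{sq}},\,2\},$$ $$n_{\mathrm{flip}}=\Bigl\lceil\tfrac{2\left((1-\frac1{1+N\kappa_{\min}})^{-1/2}-1\right)}{\sqrt{\varepsilon/N}}\Bigr\rceil,\quad n_{\mathrm{sq}}=\Bigl\lceil\tfrac{B_y+B_\alpha}{\sqrt{\varepsilon/N}}\Bigr\rceil,\quad \widetilde n_{\mathrm{sq}}=\Bigl\lceil\tfrac{B_w+B_\alpha}{\sqrt{\varepsilon/N^2}}\Bigr\rceil,\quad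 n_{\mathrm{inv}}=\bigl\lceil3\sqrt{(N+1)/\varepsilon}\,\bigr\rceil,\quad \widehat n_{\mathrm{sq}}=\Bigl\lceil\tfrac{B_w+3}{\sqrt{\varepsilon/N}}\Bigr\rceil,$$ with $B_\alpha=\frac1{N\kappa_{\min}}+\frac1N$ and $$B_w=\frac1{\sqrt N}\Bigl(\frac{(\frac1{\sqrt{\lambda_0}}+1)B_y}{\lambda_0\sqrt{\kappa_{\min}}}+\frac{\frac{B_y}{\sqrt{\lambda_0}}+2(1+\lambda_0)}{\lambda_0(1-c)\sqrt{\kappa_{\min}}}\Bigr)+\frac1N\,\frac{(\frac1{\sqrt{\lambda_0}}+1)B_y}{\lambda_0}.$$ Moreover $L\le C_1\log(1/\varepsilon)$ for all $\varepsilon\in(0,c)$, with $C_1$ depending only on $c,\lambda_0,\eta$ (and $\kappa_{\min},B_y$), and $W\le C_2\sqrt{N/\varepsilon}$ for all $N\ge1$ and $\varepsilon\in(0,c)$, with $C_2$ depending only on $c,\lambda_0,B_y,\kappa_{\min}$. -/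

import Mathlib

namespace KernelICL

noncomputable section

/-! ### Single-head softmax transformers with ReLU MLPs -/

/-- The parameters of one transformer block acting on matrices whose columns are the tokens:
features are indexed by `ι`, tokens by `τ`, and the MLP has `W` hidden neurons.
The mask matrix `M` has entries in `{0, -∞}`; `visible i j = true` means `M i j = 0` and
`visible i j = false` means `M i j = -∞` (token `i` does not attend to token `j`).
As the softmax requires, every row of `M` has a finite entry. -/
structure Block (ι τ : Type*) (W : ℕ) where
  WQ : Matrix ι ι ℝ
  WK : Matrix ι ι ℝ
  WV : Matrix ι ι ℝ
  visible : τ → τ → Bool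
  exists_visible : ∀ i, ∃ j, visible i j = true
  Win : Matrix (Fin W) ι ℝ
  Wout : Matrix ι (Fin W) ℝ

namespace Block

variable {ι τ : Type*} [Fintype ι] [Fintype τ] {W : ℕ}

/-- The numerator `exp (⟨WQ zᵢ, WK zⱼ⟩ + M i j)` of the masked softmax. -/
def expScore (b : Block ι τ W) (Z : Matrix ι τ ℝ) (i j : τ) : ℝ :=
  if b.visible i j then Real.exp (∑ a, (b.WQ * Z) a i * (b.WK * Z) a j) else 0

/-- The attention probability that token `i` gives to token `j`. -/
def attnWeight (b : Block ι τ W) (Z : Matrix ι τ ℝ) (i j : τ) : ℝ :=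
  b.expScore Z i j / ∑ j', b.expScore Z i j'

/-- Single-head softmax attention with residual connection:
`zᵢ ↦ zᵢ + ∑ⱼ softmaxⱼ (⟨WQ zᵢ, WK zⱼ⟩ + M i j) • WV zⱼ`. -/
def attn (b : Block ι τ W) (Z : Matrix ι τ ℝ) : Matrix ι τ ℝ :=
  Matrix.of fun a i => Z a i + ∑ j, b.attnWeight Z i j * (b.WV * Z) a j

/-- Token-wise ReLU MLP with residual connection: `zᵢ ↦ zᵢ + Wout ReLU (Win zᵢ)`. -/
def mlp (b : Block ι τ W) (Z : Matrix ι τ ℝ) : Matrix ι τ ℝ :=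
  Z + b.Wout * (b.Win * Z).map (fun u => max u 0)

/-- A block is an attention layer followed by an MLP layer. -/
def apply (b : Block ι τ W) (Z : Matrix ι τ ℝ) : Matrix ι τ ℝ :=
  b.mlp (b.attn Z)

end Block

/-- A transformer of MLP width `W` is a finite sequence of blocks; the first one acts first. -/
abbrev Transformer (ι τ : Type*) (W : ℕ) := List (Block ι τ W)

/-- The map computed by a transformer. -/
def Transformer.apply {ι τ : Type*} [Fintype ι] [Fintype τ] {W : ℕ}
    (TF : Transformer ι τ W) (Z : Matrix ι τ ℝ) : Matrix ι τ ℝ :=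
  TF.foldl (fun Z' b => b.apply Z') Z

/-! ### The in-context prompt -/

/-- The `D = d + 11` features of a token: the `d` coordinates of the input `x`, and eleven scalar
features `y, w, ‖x‖², k, α, β, p, k̂, s, t, 1` in this order. -/
abbrev Feature (d : ℕ) := Fin d ⊕ Fin 11

/-- Inputs of the `N + 2` tokens: the dummy token `0`, the `N` training inputs, the test input. -/
def tokenX {d N : ℕ} (x : Fin N → EuclideanSpace ℝ (Fin d)) (xtest : EuclideanSpace ℝ (Fin d)) :
    Fin (N + 2) → EuclideanSpace ℝ (Fin d) :=
  Fin.cons (α := fun _ => EuclideanSpace ℝ (Fin d)) 0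
    (Fin.snoc (α := fun _ => EuclideanSpace ℝ (Fin d)) x xtest)

/-- Labels of the `N + 2` tokens; those of the dummy token and of the test token are `0`. -/
def tokenY {N : ℕ} (y : Fin N → ℝ) : Fin (N + 2) → ℝ :=
  Fin.cons (α := fun _ => ℝ) 0 (Fin.snoc (α := fun _ => ℝ) y 0)

/-- The prompt matrix `Z` with columns `zᵢ = (xᵢ, yᵢ, 0, ‖xᵢ‖², 0, 0, 0, 0, 0, sᵢ, tᵢ, 1)`, where
`sᵢ` marks the dummy token and `tᵢ` marks the test token. -/
def prompt {d N : ℕ} (x : Fin N → EuclideanSpace ℝ (Fin d)) (y : Fin N → ℝ)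
    (xtest : EuclideanSpace ℝ (Fin d)) : Matrix (Feature d) (Fin (N + 2)) ℝ :=
  Matrix.of fun a i => Sum.elim (fun k : Fin d => tokenX x xtest i k)
    (![tokenY y i, 0, ‖tokenX x xtest i‖ ^ 2, 0, 0, 0, 0, 0,
      if i = 0 then 1 else 0, if i = Fin.last (N + 1) then 1 else 0, 1]) a

/-- The prediction is read from the label entry of the test token. -/
def readout {d N : ℕ} (Z : Matrix (Feature d) (Fin (N + 2)) ℝ) : ℝ :=
  Z (Sum.inr 0) (Fin.last (N + 1))

/-! ### Gaussian kernel ridge regression -/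

/-- The Gaussian kernel of bandwidth `v`. -/
def gaussKernel {d : ℕ} (v : ℝ) (x x' : EuclideanSpace ℝ (Fin d)) : ℝ :=
  Real.exp (-‖x - x'‖ ^ 2 / (2 * v ^ 2))

/-- The kernel matrix of the training inputs. -/
def gram {d N : ℕ} (v : ℝ) (x : Fin N → EuclideanSpace ℝ (Fin d)) : Matrix (Fin N) (Fin N) ℝ :=
  Matrix.of fun i j => gaussKernel v (x i) (x j)

/-- `w` solves the linear system `(K + λ I) w = y` with ridge parameter `λ = lam0 * N`. -/
def IsKRRSolution {d N : ℕ} (v lam0 : ℝ) (x : Fin N → EuclideanSpace ℝ (Fin d)) (y : Fin N → ℝ)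
    (w : Fin N → ℝ) : Prop :=
  (gram v x + (lam0 * N) • (1 : Matrix (Fin N) (Fin N) ℝ)).mulVec w = y

/-! ### Explicit constants -/

/-- Bound on the approximate inverse row sums of the kernel matrix. -/
def Balpha (kmin : ℝ) (N : ℕ) : ℝ := 1 / (N * kmin) + 1 / N

/-- Bound on the entries of the iterates. -/
def Bw (c lam0 By kmin : ℝ) (N : ℕ) : ℝ :=
  1 / √N * ((1 / √lam0 + 1) * By / (lam0 * √kmin)
      + (By / √lam0 + 2 * (1 + lam0)) / (lam0 * (1 - c) * √kmin))
    + 1 / N * ((1 / √lam0 + 1) * By / lam0)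

/-- The constant in front of `ε` in the final error bound. -/
def Csys (c lam0 By kmin : ℝ) : ℝ :=
  (1 / √lam0 + 1) * By / lam0 * (2 / √kmin + 1)
    + 2 * ((By / √lam0 + 2 * (1 + lam0)) / (lam0 * (1 - c) * √kmin)) + 1 / 2

/-- The number of iterations. -/
def numIter (c lam0 η ε : ℝ) : ℕ :=
  ⌈Real.log (1 / ε) / Real.log (1 / (1 - η * lam0 * (1 - c)))⌉₊

def nFlip (kmin : ℝ) (N : ℕ) (ε : ℝ) : ℕ :=
  ⌈2 * (1 / √(1 - 1 / (1 + N * kmin)) - 1) / √(ε / N)⌉₊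

def nSq (By kmin : ℝ) (N : ℕ) (ε : ℝ) : ℕ :=
  ⌈(By + Balpha kmin N) / √(ε / N)⌉₊

def nSqTilde (c lam0 By kmin : ℝ) (N : ℕ) (ε : ℝ) : ℕ :=
  ⌈(Bw c lam0 By kmin N + Balpha kmin N) / √(ε / N ^ 2)⌉₊

def nInv (N : ℕ) (ε : ℝ) : ℕ := ⌈3 * √((N + 1) / ε)⌉₊

def nSqHat (c lam0 By kmin : ℝ) (N : ℕ) (ε : ℝ) : ℕ :=
  ⌈(Bw c lam0 By kmin N + 3) / √(ε / N)⌉₊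

/-- The MLP width of the transformer. -/
def width (c lam0 By kmin : ℝ) (N : ℕ) (ε : ℝ) : ℕ :=
  max (nFlip kmin N ε) (max (2 * nSq By kmin N ε) (max (2 * nSqTilde c lam0 By kmin N ε + 4)
    (max (nInv N ε) (max (2 * nSqHat c lam0 By kmin N ε) 2))))

end

end KernelICL

open KernelICL

namespace KernelICL

open Matrix

/-! ### Positivity of the Gaussian kernel -/

/-! Softmax attention becomes nearly linear once one token dominates it. The dummy token gets score
R from every other token and carries the value 0, while a training token gets score exactly log
K(x_i, x_j). A head therefore returns the kernel sum of the `w`-features divided by e^R + Σ K.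
Rescaling by e^R leaves the exact kernel sum times a factor `damping` within N e^{-R} of 1.

Each of the first 2L+4 blocks thus performs one gradient step for ridge regression on the
`w`-features, perturbed only by these factors, and a last block writes the kernel sum into the label
of the test token. The MLP only has to apply a linear form, for which two neurons suffice.

Convergence rests on 0 ≤ K and K² ≤ N K (`gaussKernel_sum_nonneg`,
`dotProduct_gram_mulVec_self_le`): an undamped step contracts by 1 - ηλ₀ in Euclidean norm. For R
large the damping degrades the rate to at most 1 - ηλ₀(1-c) and adds a stationary error ε‖w‖
(`l2norm_iterate_dampedStep_sub_le`). As √N‖w‖ ≤ B_y/λ₀, the prediction error is at most 3(B_y/λ₀)ε.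
-/

theorem sum_mul_inner_pow_nonneg {d : ℕ} {ι : Type*} [Fintype ι]
    (x : ι → EuclideanSpace ℝ (Fin d)) (u : ι → ℝ) (n : ℕ) :
    0 ≤ ∑ i, ∑ j, u i * u j * (∑ k, x i k * x j k) ^ n := by
  -- Expanding the power over words f in the coordinates exhibits the tensor-power feature map, so
  -- the form is a sum of squares.
  have key : ∀ i j, (∑ k, x i k * x j k) ^ n
      = ∑ f : Fin n → Fin d, (∏ m, x i (f m)) * ∏ m, x j (f m) := by
    intro i j
    simp_rw [← Finset.prod_mul_distrib]
    rw [Fintype.sum_pow]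
  have : ∑ i, ∑ j, u i * u j * (∑ k, x i k * x j k) ^ n
      = ∑ f : Fin n → Fin d, (∑ i, u i * ∏ m, x i (f m)) ^ 2 := by
    simp_rw [key, sq, Finset.sum_mul_sum, Finset.mul_sum]
    rw [Finset.sum_comm_cycle]
    refine Finset.sum_congr rfl fun f _ => ?_
    rw [Finset.sum_comm]
    refine Finset.sum_congr rfl fun i _ => Finset.sum_congr rfl fun j _ => by ring
  rw [this]
  positivity

theorem norm_sub_sq_eq_sum {d : ℕ} (x y : EuclideanSpace ℝ (Fin d)) :
    ‖x - y‖ ^ 2 = ‖x‖ ^ 2 + ‖y‖ ^ 2 - 2 * ∑ k, x k * y k := by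
  simp only [EuclideanSpace.norm_sq_eq, Real.norm_eq_abs, sq_abs, PiLp.sub_apply, Finset.mul_sum,
    ← Finset.sum_add_distrib, ← Finset.sum_sub_distrib]
  exact Finset.sum_congr rfl fun k _ => by ring

theorem gaussKernel_eq {d : ℕ} (v : ℝ) (x y : EuclideanSpace ℝ (Fin d)) :
    gaussKernel v x y = Real.exp (-‖x‖ ^ 2 / (2 * v ^ 2)) * Real.exp (-‖y‖ ^ 2 / (2 * v ^ 2))
      * Real.exp ((∑ k, x k * y k) / v ^ 2) := by
  rw [gaussKernel, norm_sub_sq_eq_sum, ← Real.exp_add, ← Real.exp_add]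
  congr 1
  rcases eq_or_ne v 0 with rfl | hv
  · simp
  · field_simp
    ring

theorem gaussKernel_pos {d : ℕ} (v : ℝ) (x y : EuclideanSpace ℝ (Fin d)) :
    0 < gaussKernel v x y := Real.exp_pos _

theorem gaussKernel_le_one {d : ℕ} (v : ℝ) (x y : EuclideanSpace ℝ (Fin d)) :
    gaussKernel v x y ≤ 1 := by
  rw [gaussKernel, Real.exp_le_one_iff]
  exact div_nonpos_of_nonpos_of_nonneg (by simp) (by positivity)

theorem gaussKernel_comm {d : ℕ} (v : ℝ) (x y : EuclideanSpace ℝ (Fin d)) :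
    gaussKernel v x y = gaussKernel v y x := by
  rw [gaussKernel, gaussKernel, norm_sub_rev]

/-- The factors exp(-‖x‖²/(2v²)) are absorbed into the coefficients. What remains is the exponential
of the inner product, a power series with nonnegative coefficients whose terms are nonnegative
forms. -/
theorem gaussKernel_sum_nonneg {d : ℕ} {ι : Type*} [Fintype ι] (v : ℝ)
    (x : ι → EuclideanSpace ℝ (Fin d)) (u : ι → ℝ) :
    0 ≤ ∑ i, ∑ j, u i * u j * gaussKernel v (x i) (x j) := by
  set r : ι → ℝ := fun i => u i * Real.exp (-‖x i‖ ^ 2 / (2 * v ^ 2)) with hr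
  have hs : HasSum (fun n : ℕ => ∑ i, ∑ j, r i * r j *
      (((∑ k, x i k * x j k) / v ^ 2) ^ n / n.factorial))
      (∑ i, ∑ j, u i * u j * gaussKernel v (x i) (x j)) := by
    refine hasSum_sum fun i _ => hasSum_sum fun j _ => ?_
    have h := (NormedSpace.expSeries_div_hasSum_exp ((∑ k, x i k * x j k) / v ^ 2)).mul_left
      (r i * r j)
    rw [← Real.exp_eq_exp_ℝ] at h
    have he : u i * u j * gaussKernel v (x i) (x j)
        = r i * r j * Real.exp ((∑ k, x i k * x j k) / v ^ 2) := by
      rw [gaussKernel_eq, hr]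
      ring
    rw [he]
    exact h
  refine hs.nonneg fun n => ?_
  have h := mul_nonneg (sum_mul_inner_pow_nonneg x r n)
    (by positivity : 0 ≤ ((v ^ 2) ^ n)⁻¹ * ((n.factorial : ℝ))⁻¹)
  convert h using 1
  simp_rw [Finset.sum_mul]
  refine Finset.sum_congr rfl fun i _ => Finset.sum_congr rfl fun j _ => ?_
  rw [div_pow]
  ring

/-! ### Gradient descent for kernel ridge regression -/

theorem dotProduct_gram_mulVec {d N : ℕ} (v : ℝ) (x : Fin N → EuclideanSpace ℝ (Fin d))
    (u w : Fin N → ℝ) :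
    u ⬝ᵥ gram v x *ᵥ w = ∑ i, ∑ j, u i * w j * gaussKernel v (x i) (x j) := by
  simp only [dotProduct, mulVec, gram, Matrix.of_apply, Finset.mul_sum]
  exact Finset.sum_congr rfl fun i _ => Finset.sum_congr rfl fun j _ => by ring

theorem dotProduct_gram_nonneg {d N : ℕ} (v : ℝ) (x : Fin N → EuclideanSpace ℝ (Fin d))
    (u : Fin N → ℝ) : 0 ≤ u ⬝ᵥ gram v x *ᵥ u := by
  rw [dotProduct_gram_mulVec]
  exact gaussKernel_sum_nonneg v x u

theorem dotProduct_gram_comm {d N : ℕ} (v : ℝ) (x : Fin N → EuclideanSpace ℝ (Fin d))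
    (u w : Fin N → ℝ) : u ⬝ᵥ gram v x *ᵥ w = w ⬝ᵥ gram v x *ᵥ u := by
  rw [dotProduct_gram_mulVec, dotProduct_gram_mulVec, Finset.sum_comm]
  refine Finset.sum_congr rfl fun i _ => Finset.sum_congr rfl fun j _ => ?_
  rw [gaussKernel_comm]
  ring

theorem sum_abs_sq_le {N : ℕ} (u : Fin N → ℝ) : (∑ i, |u i|) ^ 2 ≤ N * (u ⬝ᵥ u) := by
  have h := sq_sum_le_card_mul_sum_sq (s := Finset.univ) (f := fun i => |u i|)
  simpa [dotProduct, ← sq] using h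

/-- The entries of K lie in [0, 1], so Cauchy–Schwarz against the all-ones vector gives K ≤ N. -/
theorem dotProduct_gram_le {d N : ℕ} (v : ℝ) (x : Fin N → EuclideanSpace ℝ (Fin d))
    (u : Fin N → ℝ) : u ⬝ᵥ gram v x *ᵥ u ≤ N * (u ⬝ᵥ u) := by
  refine le_trans ?_ (sum_abs_sq_le u)
  rw [dotProduct_gram_mulVec, sq, Finset.sum_mul_sum]
  refine Finset.sum_le_sum fun i _ => Finset.sum_le_sum fun j _ => ?_
  calc u i * u j * gaussKernel v (x i) (x j)
      ≤ |u i * u j| * gaussKernel v (x i) (x j) :=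
        mul_le_mul_of_nonneg_right (le_abs_self _) (gaussKernel_pos _ _ _).le
    _ ≤ |u i * u j| * 1 := by gcongr; exact gaussKernel_le_one _ _ _
    _ = |u i| * |u j| := by rw [mul_one, abs_mul]

/-- This is K² ≤ N K, obtained without diagonalization: positivity is tested on N u - K u, and the
cubic term is removed by K ≤ N applied to K u. -/
theorem dotProduct_gram_mulVec_self_le {d N : ℕ} (hN : 1 ≤ N) (v : ℝ)
    (x : Fin N → EuclideanSpace ℝ (Fin d)) (u : Fin N → ℝ) :
    (gram v x *ᵥ u) ⬝ᵥ (gram v x *ᵥ u) ≤ N * (u ⬝ᵥ gram v x *ᵥ u) := by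
  have hN' : (0 : ℝ) < N := by exact_mod_cast hN
  set q := gram v x *ᵥ u with hq
  have h1 := dotProduct_gram_nonneg v x ((N : ℝ) • u - q)
  have h2 := dotProduct_gram_le v x q
  have h3 := dotProduct_gram_comm v x u q
  simp only [mulVec_sub, mulVec_smul, sub_dotProduct, dotProduct_sub, smul_dotProduct,
    dotProduct_smul, smul_eq_mul, ← hq] at h1 h2 h3
  rw [h3] at h1
  have : 0 ≤ (N : ℝ) * (N * (u ⬝ᵥ q) - q ⬝ᵥ q) := by nlinarith
  linarith [nonneg_of_mul_nonneg_right this hN']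

/-- The Euclidean norm of a vector of coefficients. -/
noncomputable def l2norm {N : ℕ} (u : Fin N → ℝ) : ℝ := ‖WithLp.toLp 2 u‖

theorem l2norm_nonneg {N : ℕ} (u : Fin N → ℝ) : 0 ≤ l2norm u := norm_nonneg _

theorem l2norm_sq {N : ℕ} (u : Fin N → ℝ) : l2norm u ^ 2 = u ⬝ᵥ u := by
  rw [l2norm, EuclideanSpace.norm_sq_eq]
  simp [dotProduct, sq]

theorem l2norm_add_le {N : ℕ} (u w : Fin N → ℝ) : l2norm (u + w) ≤ l2norm u + l2norm w := by
  rw [l2norm, WithLp.toLp_add]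
  exact norm_add_le _ _

theorem l2norm_le_of_dotProduct_le {N : ℕ} {u : Fin N → ℝ} {b : ℝ} (hb : 0 ≤ b)
    (h : u ⬝ᵥ u ≤ b ^ 2) : l2norm u ≤ b := by
  rw [← l2norm_sq] at h
  exact le_of_sq_le_sq h hb

theorem dotProduct_le_l2norm_mul {N : ℕ} (u w : Fin N → ℝ) : u ⬝ᵥ w ≤ l2norm u * l2norm w := by
  have h := real_inner_le_norm (WithLp.toLp 2 w : EuclideanSpace ℝ (Fin N)) (WithLp.toLp 2 u)
  rw [EuclideanSpace.inner_toLp_toLp] at h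
  simpa [l2norm, mul_comm] using h

theorem sum_abs_le {N : ℕ} (u : Fin N → ℝ) : ∑ i, |u i| ≤ √N * l2norm u := by
  refine le_of_sq_le_sq ?_ (mul_nonneg (Real.sqrt_nonneg _) (l2norm_nonneg _))
  rw [mul_pow, Real.sq_sqrt (Nat.cast_nonneg _), l2norm_sq]
  exact sum_abs_sq_le u

theorem l2norm_le_of_forall_abs_le {N : ℕ} {u : Fin N → ℝ} {b : ℝ} (hb : 0 ≤ b)
    (h : ∀ i, |u i| ≤ b) : l2norm u ≤ √N * b := by
  refine l2norm_le_of_dotProduct_le (by positivity) ?_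
  rw [mul_pow, Real.sq_sqrt (Nat.cast_nonneg _)]
  calc u ⬝ᵥ u ≤ ∑ _i : Fin N, b ^ 2 :=
        Finset.sum_le_sum fun i _ => by
          rw [← sq]
          exact sq_le_sq' (abs_le.1 (h i)).1 (abs_le.1 (h i)).2
    _ = N * b ^ 2 := by simp

theorem abs_sum_mul_le {N : ℕ} (u κ : Fin N → ℝ) (h0 : ∀ i, 0 ≤ κ i) (h1 : ∀ i, κ i ≤ 1) :
    |∑ i, u i * κ i| ≤ √N * l2norm u := by
  refine ((Finset.abs_sum_le_sum_abs _ _).trans (Finset.sum_le_sum fun i _ => ?_)).trans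
    (sum_abs_le u)
  rw [abs_mul, abs_of_nonneg (h0 i)]
  exact mul_le_of_le_one_right (abs_nonneg _) (h1 i)

/-- One gradient step contracts towards the ridge solution. -/
theorem l2norm_gradient_step_le {d N : ℕ} (hN : 1 ≤ N) (v : ℝ)
    (x : Fin N → EuclideanSpace ℝ (Fin d)) {ρ η : ℝ} (hη : 0 ≤ η) (hρ : η ≤ 2 * ρ)
    (u : Fin N → ℝ) : l2norm (ρ • u - (η / N) • gram v x *ᵥ u) ≤ ρ * l2norm u := by
  have hN' : (0 : ℝ) < N := by exact_mod_cast hN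
  have hρ0 : 0 ≤ ρ := by linarith
  refine l2norm_le_of_dotProduct_le (mul_nonneg hρ0 (l2norm_nonneg u)) ?_
  have h1 := dotProduct_gram_mulVec_self_le hN v x u
  have h2 := dotProduct_gram_nonneg v x u
  set q := gram v x *ᵥ u
  simp only [sub_dotProduct, dotProduct_sub, smul_dotProduct, dotProduct_smul, smul_eq_mul,
    mul_pow, l2norm_sq, dotProduct_comm q u]
  have h3 : (η / N) * ((η / N) * (q ⬝ᵥ q)) ≤ (η / N) * η * (u ⬝ᵥ q) := by
    have : (η / N) * (q ⬝ᵥ q) ≤ (η / N) * (N * (u ⬝ᵥ q)) := by gcongr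
    calc (η / N) * ((η / N) * (q ⬝ᵥ q)) ≤ (η / N) * ((η / N) * (N * (u ⬝ᵥ q))) := by gcongr
      _ = (η / N) * η * (u ⬝ᵥ q) := by field_simp
  -- The cross term -2ρ(η/N) u·Ku outweighs the quadratic term precisely because η ≤ 2ρ.
  have h4 : 0 ≤ (η / N) * (2 * ρ - η) * (u ⬝ᵥ q) :=
    mul_nonneg (mul_nonneg (by positivity) (by linarith)) h2
  nlinarith

/-- Since K ≥ 0, the ridge term makes the form definite. The matrix is then injective, hence
invertible. -/
theorem existsUnique_isKRRSolution {d N : ℕ} (hN : 1 ≤ N) (v : ℝ) {lam0 : ℝ} (hlam0 : 0 < lam0)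
    (x : Fin N → EuclideanSpace ℝ (Fin d)) (y : Fin N → ℝ) :
    ∃ w, IsKRRSolution v lam0 x y w ∧ ∀ w', IsKRRSolution v lam0 x y w' → w' = w := by
  have hN' : (0 : ℝ) < N := by exact_mod_cast hN
  have hinj : Function.Injective
      (gram v x + (lam0 * N) • (1 : Matrix (Fin N) (Fin N) ℝ)).mulVec := by
    intro a b hab
    have h0 : (gram v x + (lam0 * N) • (1 : Matrix (Fin N) (Fin N) ℝ)) *ᵥ (a - b) = 0 := by
      rw [mulVec_sub, sub_eq_zero]
      exact hab
    have h1 := congrArg (fun q => (a - b) ⬝ᵥ q) h0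
    simp only [add_mulVec, smul_mulVec, one_mulVec, dotProduct_add, dotProduct_smul, smul_eq_mul,
      dotProduct_zero] at h1
    have h2 := dotProduct_gram_nonneg v x (a - b)
    have h3 : (a - b) ⬝ᵥ (a - b) = 0 := by
      have h4 : 0 ≤ (a - b) ⬝ᵥ (a - b) := by rw [← l2norm_sq]; positivity
      have : 0 < lam0 * N := by positivity
      nlinarith
    exact sub_eq_zero.1 (dotProduct_self_eq_zero.1 h3)
  have hunit := mulVec_injective_iff_isUnit.1 hinj
  obtain ⟨w, hw⟩ := (mulVec_surjective_iff_isUnit.2 hunit) y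
  exact ⟨w, hw, fun w' hw' => hinj (hw'.trans hw.symm)⟩

theorem IsKRRSolution.gram_mulVec_eq {d N : ℕ} {v lam0 : ℝ}
    {x : Fin N → EuclideanSpace ℝ (Fin d)} {y w : Fin N → ℝ} (h : IsKRRSolution v lam0 x y w) :
    gram v x *ᵥ w + (lam0 * N) • w = y := by
  rw [IsKRRSolution, add_mulVec, smul_mulVec, one_mulVec] at h
  exact h

/-- Pairing the linear system with w and dropping the nonnegative kernel term leaves λ₀N‖w‖² ≤ w·y ≤
‖w‖ √N B_y. -/
theorem IsKRRSolution.sqrt_mul_l2norm_le {d N : ℕ} (hN : 1 ≤ N) {v lam0 By : ℝ} (hlam0 : 0 < lam0)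
    {x : Fin N → EuclideanSpace ℝ (Fin d)} {y w : Fin N → ℝ} (h : IsKRRSolution v lam0 x y w)
    (hBy : 0 ≤ By) (hy : ∀ i, |y i| ≤ By) : √N * l2norm w ≤ By / lam0 := by
  have hN' : (0 : ℝ) < N := by exact_mod_cast hN
  have h1 := congrArg (fun q => w ⬝ᵥ q) h.gram_mulVec_eq
  simp only [dotProduct_add, dotProduct_smul, smul_eq_mul] at h1
  have h2 := dotProduct_gram_nonneg v x w
  have h3 := dotProduct_le_l2norm_mul w y
  have h4 := l2norm_le_of_forall_abs_le hBy hy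
  have h0 := l2norm_nonneg w
  rw [← l2norm_sq w] at h1
  rw [le_div_iff₀ hlam0]
  rcases h0.eq_or_lt with h5 | h5
  · rw [← h5]
    simpa using hBy
  · have h6 : l2norm w * (lam0 * N * l2norm w) ≤ l2norm w * (√N * By) := by
      nlinarith [mul_le_mul_of_nonneg_left h4 h0]
    have h7 := le_of_mul_le_mul_left h6 h5
    have h8 : √N * (√N * l2norm w * lam0) ≤ √N * By := by
      calc √N * (√N * l2norm w * lam0) = (√N * √N) * l2norm w * lam0 := by ring
        _ = lam0 * N * l2norm w := by rw [Real.mul_self_sqrt hN'.le]; ring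
        _ ≤ _ := h7
    exact le_of_mul_le_mul_left h8 (Real.sqrt_pos.2 hN')

/-- The gradient step with damping factors `θ`, which the attention layer realizes. -/
noncomputable def dampedStep {d N : ℕ} (v lam0 η : ℝ) (x : Fin N → EuclideanSpace ℝ (Fin d))
    (y θ w : Fin N → ℝ) : Fin N → ℝ :=
  fun i => (1 - η * lam0) * w i - η / N * (θ i * (gram v x *ᵥ w) i) + η / N * y i

theorem abs_gram_mulVec_le {d N : ℕ} (v : ℝ) (x : Fin N → EuclideanSpace ℝ (Fin d))
    (w : Fin N → ℝ) (i : Fin N) : |(gram v x *ᵥ w) i| ≤ √N * l2norm w := by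
  have h := abs_sum_mul_le w (fun j => gaussKernel v (x i) (x j))
    (fun j => (gaussKernel_pos _ _ _).le) (fun j => gaussKernel_le_one _ _ _)
  simpa only [mulVec, dotProduct, gram, Matrix.of_apply, mul_comm] using h

/-- The ridge solution is fixed by the undamped step, so the error is a contracted copy of u - w
plus the damping defect (η/N)(1-θ)Ku. The defect has norm at most ηδ‖u‖, and ‖u‖ ≤ ‖u - w‖ + ‖w‖. -/
theorem l2norm_dampedStep_sub_le {d N : ℕ} (hN : 1 ≤ N) {v lam0 η δ : ℝ} (hη : 0 ≤ η)
    (hη2 : η * (1 + 2 * lam0) ≤ 2) (hδ : 0 ≤ δ) {x : Fin N → EuclideanSpace ℝ (Fin d)}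
    {y w θ : Fin N → ℝ} (hw : IsKRRSolution v lam0 x y w) (hθ : ∀ i, |1 - θ i| ≤ δ)
    (u : Fin N → ℝ) :
    l2norm (dampedStep v lam0 η x y θ u - w)
      ≤ (1 - η * lam0 + η * δ) * l2norm (u - w) + η * δ * l2norm w := by
  have hN' : (0 : ℝ) < N := by exact_mod_cast hN
  have hdec : dampedStep v lam0 η x y θ u - w
      = ((1 - η * lam0) • (u - w) - (η / N) • gram v x *ᵥ (u - w))
        + fun i => η / N * ((1 - θ i) * (gram v x *ᵥ u) i) := by
    ext i
    have h := congrFun hw.gram_mulVec_eq i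
    simp only [Pi.add_apply, Pi.smul_apply, smul_eq_mul] at h
    simp only [dampedStep, Pi.sub_apply, Pi.add_apply, Pi.smul_apply, smul_eq_mul, mulVec_sub, ← h]
    field_simp
    ring
  have h1 := l2norm_gradient_step_le hN v x (ρ := 1 - η * lam0) hη (by linarith) (u - w)
  have h2 : l2norm (fun i => η / N * ((1 - θ i) * (gram v x *ᵥ u) i)) ≤ η * δ * l2norm u := by
    have h3 : ∀ i, |η / N * ((1 - θ i) * (gram v x *ᵥ u) i)| ≤ η / N * (δ * (√N * l2norm u)) := by
      intro i
      rw [abs_mul, abs_mul, abs_of_nonneg (by positivity : 0 ≤ η / (N : ℝ))]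
      gcongr
      · exact hθ i
      · exact abs_gram_mulVec_le v x u i
    refine (l2norm_le_of_forall_abs_le ?_ h3).trans_eq ?_
    · have := l2norm_nonneg u
      positivity
    · calc √N * (η / N * (δ * (√N * l2norm u))) = (√N * √N) / N * (η * δ * l2norm u) := by ring
        _ = _ := by rw [Real.mul_self_sqrt hN'.le, div_self hN'.ne', one_mul]
  have h4 : l2norm u ≤ l2norm (u - w) + l2norm w := by
    have := l2norm_add_le (u - w) w
    rwa [sub_add_cancel] at this
  rw [hdec]
  have h5 := l2norm_add_le ((1 - η * lam0) • (u - w) - (η / N) • gram v x *ᵥ (u - w))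
    (fun i => η / N * ((1 - θ i) * (gram v x *ᵥ u) i))
  have h6 : η * δ * l2norm u ≤ η * δ * (l2norm (u - w) + l2norm w) := by gcongr
  nlinarith

/-- The level τ absorbs the perturbation: qτ + ηδ ≤ τ. The geometric part starts from the error ‖w‖
of the zero vector. -/
theorem l2norm_iterate_dampedStep_sub_le {d N : ℕ} (hN : 1 ≤ N) {v lam0 η δ q τ : ℝ} (hη : 0 ≤ η)
    (hη2 : η * (1 + 2 * lam0) ≤ 2) (hδ : 0 ≤ δ) {x : Fin N → EuclideanSpace ℝ (Fin d)}
    {y w θ : Fin N → ℝ} (hw : IsKRRSolution v lam0 x y w) (hθ : ∀ i, |1 - θ i| ≤ δ)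
    (hq0 : 0 ≤ q) (hq : 1 - η * lam0 + η * δ ≤ q) (hτ0 : 0 ≤ τ) (hτ : η * δ ≤ τ * (1 - q))
    (n : ℕ) :
    l2norm ((dampedStep v lam0 η x y θ)^[n] 0 - w) ≤ (q ^ n + τ) * l2norm w := by
  have hw0 := l2norm_nonneg w
  induction n with
  | zero =>
    have : l2norm (0 - w) = l2norm w := by simp [l2norm]
    simp only [Function.iterate_zero, id_eq, pow_zero, this]
    nlinarith
  | succ n ih =>
    rw [Function.iterate_succ_apply']
    have h1 := l2norm_dampedStep_sub_le hN hη hη2 hδ hw hθ ((dampedStep v lam0 η x y θ)^[n] 0)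
    have h2 := l2norm_nonneg ((dampedStep v lam0 η x y θ)^[n] 0 - w)
    calc _ ≤ _ := h1
      _ ≤ q * ((q ^ n + τ) * l2norm w) + τ * (1 - q) * l2norm w := by gcongr
      _ = (q ^ (n + 1) + τ) * l2norm w := by ring

/-! ### The transformer -/

/-- The columns of the prompt, with the `w`-features replaced by `ω`. -/
noncomputable def promptWith {d N : ℕ} (x : Fin N → EuclideanSpace ℝ (Fin d)) (y : Fin N → ℝ)
    (xtest : EuclideanSpace ℝ (Fin d)) (ω : Fin (N + 2) → ℝ) :
    Matrix (Feature d) (Fin (N + 2)) ℝ :=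
  Matrix.of fun a i => Sum.elim (fun k : Fin d => tokenX x xtest i k)
    (![tokenY y i, ω i, ‖tokenX x xtest i‖ ^ 2, 0, 0, 0, 0, 0,
      if i = 0 then 1 else 0, if i = Fin.last (N + 1) then 1 else 0, 1]) a

/-- The key matrix for which, up to a term independent of the key, the score of a data token is
the logarithm of the Gaussian kernel, and the score of the dummy token is `R`. -/
noncomputable def keyMatrix (d : ℕ) (v R : ℝ) : Matrix (Feature d) (Feature d) ℝ :=
  Matrix.of fun a b => match a, b with
    | .inl k, .inl l => if k = l then 1 / v ^ 2 else 0
    | .inr a, .inr b =>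
      -- Row 2 meets the query entry ‖x_i‖² and yields -1/(2v²), cancelled to 0 for the dummy key.
      -- Row 10 meets the query constant 1 and yields -‖x_j‖²/(2v²), plus R for the dummy key.
      if a = 2 then (if b = 8 then 1 / (2 * v ^ 2) else if b = 10 then -1 / (2 * v ^ 2) else 0)
      else if a = 10 then (if b = 2 then -1 / (2 * v ^ 2) else if b = 8 then R else 0)
      else 0
    | _, _ => 0

/-- The dummy token attends to itself, the others to all tokens but the test token. -/
def kernelMask (N : ℕ) (i j : Fin (N + 2)) : Bool :=
  -- Self-attention keeps the `w`-feature of the dummy at 0. Hiding the test token keeps its own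
  -- evolving `w`-feature out of every sum.
  if i = 0 then decide (j = 0) else decide (j ≠ Fin.last (N + 1))

theorem exists_kernelMask {N : ℕ} (i : Fin (N + 2)) : ∃ j, kernelMask N i j = true := by
  refine ⟨0, ?_⟩
  unfold kernelMask
  split_ifs <;> simp [Fin.ext_iff]

/-- Kernel attention which adds `b` times the (approximate, scaled) kernel sum of the `w`-features
to the row `r`, followed by an MLP which adds the linear form `l` of the
scalar features of a token to its `w`-feature. -/
noncomputable def kernelBlock {d : ℕ} (N W : ℕ) (v R : ℝ) (r : Fin 11) (b : ℝ)
    (l : Fin 11 → ℝ) : Block (Feature d) (Fin (N + 2)) W where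
  WQ := 1
  WK := keyMatrix d v R
  WV := Matrix.single (Sum.inr r) (Sum.inr 1) b
  visible := kernelMask N
  exists_visible := exists_kernelMask
  -- Two neurons realize the linear form through s = ReLU(s) - ReLU(-s); any others are zero.
  Win := Matrix.of fun q a => if q.val = 0 then Sum.elim (fun _ => 0) l a
    else if q.val = 1 then -Sum.elim (fun _ => 0) l a else 0
  Wout := Matrix.of fun a q => if a = Sum.inr 1 then
    (if q.val = 0 then 1 else if q.val = 1 then -1 else 0) else 0

/-! ### Action of the kernel blocks on prompts -/

section

variable {d N : ℕ} (x : Fin N → EuclideanSpace ℝ (Fin d)) (y : Fin N → ℝ)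
  (xtest : EuclideanSpace ℝ (Fin d))

theorem keyMatrix_mul_promptWith_inl (v R : ℝ) (ω : Fin (N + 2) → ℝ) (k : Fin d)
    (j : Fin (N + 2)) :
    (keyMatrix d v R * promptWith x y xtest ω) (Sum.inl k) j = tokenX x xtest j k / v ^ 2 := by
  simp [Matrix.mul_apply, keyMatrix, promptWith, Fintype.sum_sum_type, div_eq_inv_mul]

theorem keyMatrix_mul_promptWith_inr (v R : ℝ) (ω : Fin (N + 2) → ℝ) (a : Fin 11)
    (j : Fin (N + 2)) :
    (keyMatrix d v R * promptWith x y xtest ω) (Sum.inr a) j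
      = if a = 2 then ((if j = 0 then 1 else 0) - 1) / (2 * v ^ 2)
        else if a = 10 then
          -‖tokenX x xtest j‖ ^ 2 / (2 * v ^ 2) + R * (if j = 0 then 1 else 0)
        else 0 := by
  rw [Matrix.mul_apply, Fintype.sum_sum_type]
  by_cases h2 : a = 2
  · subst h2
    simp [keyMatrix, promptWith, Fin.sum_univ_succ]
    split_ifs <;> ring
  · by_cases h10 : a = 10
    · subst h10
      simp [keyMatrix, promptWith, Fin.sum_univ_succ]
      ring
    · simp [keyMatrix, h2, h10]

variable {W : ℕ} (v R : ℝ) (r : Fin 11) (b : ℝ) (l : Fin 11 → ℝ) (ω : Fin (N + 2) → ℝ)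

theorem kernelBlock_expScore (i j : Fin (N + 2)) :
    (kernelBlock (d := d) N W v R r b l).expScore (promptWith x y xtest ω) i j
      = if kernelMask N i j then
          Real.exp ((∑ k, tokenX x xtest i k * tokenX x xtest j k) / v ^ 2
            + (‖tokenX x xtest i‖ ^ 2 * (((if j = 0 then 1 else 0) - 1) / (2 * v ^ 2))
            + (-‖tokenX x xtest j‖ ^ 2 / (2 * v ^ 2) + R * (if j = 0 then 1 else 0))))
        else 0 := by
  unfold Block.expScore
  refine if_congr Iff.rfl (congrArg Real.exp ?_) rfl
  simp only [kernelBlock, Matrix.one_mul, Fintype.sum_sum_type, keyMatrix_mul_promptWith_inl,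
    keyMatrix_mul_promptWith_inr]
  congr 1
  · simp [promptWith, mul_div_assoc, Finset.sum_div]
  · simp [promptWith, Fin.sum_univ_succ]

theorem kernelBlock_expScore_dummy {i : Fin (N + 2)} (hi : i ≠ 0) :
    (kernelBlock (d := d) N W v R r b l).expScore (promptWith x y xtest ω) i 0 = Real.exp R := by
  rw [kernelBlock_expScore]
  have h : (0 : Fin (N + 2)) ≠ Fin.last (N + 1) := by simp [Fin.ext_iff]
  simp [kernelMask, hi, h, tokenX]

theorem kernelBlock_expScore_test {i : Fin (N + 2)} (hi : i ≠ 0) :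
    (kernelBlock (d := d) N W v R r b l).expScore (promptWith x y xtest ω) i (Fin.last N).succ
      = 0 := by
  rw [kernelBlock_expScore]
  simp [kernelMask, hi]

theorem kernelBlock_expScore_train (hv : 0 < v) {i : Fin (N + 2)} (hi : i ≠ 0) (j : Fin N) :
    (kernelBlock (d := d) N W v R r b l).expScore (promptWith x y xtest ω) i j.castSucc.succ
      = gaussKernel v (tokenX x xtest i) (x j) := by
  rw [kernelBlock_expScore]
  have h : j.castSucc.succ ≠ Fin.last (N + 1) := by
    rw [← Fin.succ_last, Ne, Fin.succ_inj]
    exact (Fin.castSucc_lt_last j).ne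
  have hx : tokenX x xtest j.castSucc.succ = x j := by
    simp only [tokenX, Fin.cons_succ, Fin.snoc_castSucc]
  rw [if_pos (by simp [kernelMask, hi, h]), hx, if_neg (Fin.succ_ne_zero _), gaussKernel,
    norm_sub_sq_eq_sum]
  congr 1
  field_simp
  ring

/-- The kernel sum at token `i` of the `w`-features of the training tokens. -/
noncomputable def kernelSum (i : Fin (N + 2)) : ℝ :=
  ∑ j : Fin N, gaussKernel v (tokenX x xtest i) (x j) * ω j.castSucc.succ

/-- The ratio between `exp R` and the softmax denominator. -/
noncomputable def damping (i : Fin (N + 2)) : ℝ :=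
  Real.exp R / (Real.exp R + ∑ j : Fin N, gaussKernel v (tokenX x xtest i) (x j))

theorem kernelBlock_WV_mul (a : Feature d) (j : Fin (N + 2)) :
    ((kernelBlock (d := d) N W v R r b l).WV * promptWith x y xtest ω) a j
      = if a = Sum.inr r then b * ω j else 0 := by
  split_ifs with h
  · subst h
    simp [kernelBlock, promptWith]
  · simp [kernelBlock, Matrix.single_mul_apply_of_ne _ _ _ _ _ h]

/-- The weight of a training token is K/(e^R + Σ K), which equals e^{-R} times the damping factor
times K. The dummy enters only through the denominator. -/
theorem kernelBlock_attn (hv : 0 < v) (hω : ω 0 = 0) {i : Fin (N + 2)} (hi : i ≠ 0)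
    (a : Feature d) :
    (kernelBlock (d := d) N W v R r b l).attn (promptWith x y xtest ω) a i
      = promptWith x y xtest ω a i + if a = Sum.inr r then
          b / Real.exp R * (damping x xtest v R i * kernelSum x xtest v ω i) else 0 := by
  simp only [Block.attn, Matrix.of_apply, kernelBlock_WV_mul]
  congr 1
  split_ifs with h
  · have hs : ∀ f : Fin (N + 2) → ℝ,
        ∑ j, f j = f 0 + (∑ j : Fin N, f j.castSucc.succ + f (Fin.last N).succ) := fun f => by
      rw [Fin.sum_univ_succ, Fin.sum_univ_castSucc]
    simp only [Block.attnWeight, hs, kernelBlock_expScore_dummy x y xtest v R r b l ω hi,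
      kernelBlock_expScore_test x y xtest v R r b l ω hi,
      kernelBlock_expScore_train x y xtest v R r b l ω hv hi, hω, damping, kernelSum,
      Finset.mul_sum]
    simp only [mul_zero, zero_add, add_zero, zero_div, zero_mul]
    refine Finset.sum_congr rfl fun j _ => ?_
    have := (Real.exp_pos R).ne'
    field_simp
  · simp

theorem kernelBlock_attn_dummy (hω : ω 0 = 0) (a : Feature d) :
    (kernelBlock (d := d) N W v R r b l).attn (promptWith x y xtest ω) a 0
      = promptWith x y xtest ω a 0 := by
  simp only [Block.attn, Matrix.of_apply, kernelBlock_WV_mul]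
  rw [add_eq_left]
  refine Finset.sum_eq_zero fun j _ => ?_
  rcases eq_or_ne j 0 with rfl | hj
  · simp [hω]
  · simp [Block.attnWeight, kernelBlock_expScore, kernelMask, hj]

theorem kernelBlock_mlp (hW : 2 ≤ W) (Z : Matrix (Feature d) (Fin (N + 2)) ℝ) (a : Feature d)
    (i : Fin (N + 2)) :
    (kernelBlock (d := d) N W v R r b l).mlp Z a i
      = Z a i + if a = Sum.inr 1 then ∑ c, l c * Z (Sum.inr c) i else 0 := by
  obtain ⟨n, rfl⟩ : ∃ n, W = n + 2 := ⟨W - 2, by omega⟩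
  simp only [Block.mlp, Matrix.add_apply]
  congr 1
  split_ifs with h
  · subst h
    rw [Matrix.mul_apply, Fin.sum_univ_succ, Fin.sum_univ_succ]
    simp [kernelBlock, Matrix.mul_apply, Fintype.sum_sum_type]
    rcases le_total 0 (∑ c, l c * Z (Sum.inr c) i) with hs | hs
    · rw [max_eq_left hs, max_eq_right (by linarith)]
      ring
    · rw [max_eq_right hs, max_eq_left (by linarith)]
      ring
  · simp [kernelBlock, Matrix.mul_apply, h]

/-- The block realizing a damped gradient step. -/
noncomputable def gradientBlock (d N W : ℕ) (v R lam0 η : ℝ) : Block (Feature d) (Fin (N + 2)) W :=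
  -- The MLP acts after attention and also multiplies the attention update by 1 - ηλ₀, so that
  -- factor is divided out beforehand; e^R undoes the softmax scale.
  kernelBlock N W v R 1 (-(η / N) / (1 - η * lam0) * Real.exp R)
    (Pi.single 0 (η / N) + Pi.single 1 (-(η * lam0)))

/-- The block which writes the kernel sum of the `w`-features to the label row. -/
noncomputable def predictionBlock (d N W : ℕ) (v R : ℝ) : Block (Feature d) (Fin (N + 2)) W :=
  kernelBlock N W v R 0 (Real.exp R) 0

theorem gradientBlock_apply (hW : 2 ≤ W) (hv : 0 < v) (hω : ω 0 = 0) {lam0 η : ℝ}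
    (h : η * lam0 < 1) :
    ∃ ω' : Fin (N + 2) → ℝ,
      (gradientBlock d N W v R lam0 η).apply (promptWith x y xtest ω) = promptWith x y xtest ω' ∧
      ω' 0 = 0 ∧
      ∀ i : Fin N, ω' i.castSucc.succ = dampedStep v lam0 η x y
        (fun i => damping x xtest v R i.castSucc.succ) (fun i => ω i.castSucc.succ) i := by
  have hy0 : ∀ ω' : Fin (N + 2) → ℝ, promptWith x y xtest ω' (Sum.inr 0) 0 = 0 := fun _ => rfl
  refine ⟨fun i => (gradientBlock d N W v R lam0 η).apply (promptWith x y xtest ω) (Sum.inr 1) i,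
    ?_, ?_, fun i => ?_⟩
  · ext a i
    by_cases ha : a = Sum.inr 1
    · subst ha
      rfl
    · have h1 : ∀ ω', promptWith x y xtest ω' a i = promptWith x y xtest ω a i := by
        intro ω'
        rcases a with k | a
        · rfl
        · fin_cases a <;> first | rfl | exact absurd rfl ha
      rw [h1, Block.apply, gradientBlock, kernelBlock_mlp _ _ _ _ _ hW, if_neg ha, add_zero]
      rcases eq_or_ne i 0 with rfl | hi
      · rw [kernelBlock_attn_dummy x y xtest v R _ _ _ ω hω]
      · rw [kernelBlock_attn x y xtest v R _ _ _ ω hv hω hi, if_neg ha, add_zero]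
  · simp only [Block.apply, gradientBlock, kernelBlock_mlp _ _ _ _ _ hW,
      kernelBlock_attn_dummy x y xtest v R _ _ _ ω hω]
    have hw0 : promptWith x y xtest ω (Sum.inr 1) 0 = 0 := hω
    simp [add_mul, Finset.sum_add_distrib, Pi.single_apply, hy0, hw0]
  · have hi : i.castSucc.succ ≠ 0 := Fin.succ_ne_zero _
    have hx : tokenX x xtest i.castSucc.succ = x i := by
      simp only [tokenX, Fin.cons_succ, Fin.snoc_castSucc]
    have hyi : promptWith x y xtest ω (Sum.inr 0) i.castSucc.succ = y i := by
      simp only [promptWith, Matrix.of_apply, Sum.elim_inr, Matrix.cons_val_zero, tokenY,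
        Fin.cons_succ, Fin.snoc_castSucc]
    have hwi : promptWith x y xtest ω (Sum.inr 1) i.castSucc.succ = ω i.castSucc.succ := rfl
    have hsum : kernelSum x xtest v ω i.castSucc.succ
        = (gram v x *ᵥ fun i => ω i.castSucc.succ) i := by
      simp only [kernelSum, hx, Matrix.mulVec, dotProduct, gram, Matrix.of_apply]
    simp only [Block.apply, gradientBlock, kernelBlock_mlp _ _ _ _ _ hW,
      kernelBlock_attn x y xtest v R _ _ _ ω hv hω hi]
    simp [add_mul, Finset.sum_add_distrib, Pi.single_apply, hyi, hwi, hsum, dampedStep]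
    have h1 : 1 - η * lam0 ≠ 0 := by linarith
    have h2 := (Real.exp_pos R).ne'
    field_simp
    ring

theorem readout_predictionBlock_apply (hW : 2 ≤ W) (hv : 0 < v) (hω : ω 0 = 0) :
    readout ((predictionBlock d N W v R).apply (promptWith x y xtest ω))
      = damping x xtest v R (Fin.last (N + 1))
        * ∑ j, ω j.castSucc.succ * gaussKernel v (x j) xtest := by
  have hl : Fin.last (N + 1) ≠ 0 := by simp [Fin.ext_iff]
  have hx : tokenX x xtest (Fin.last (N + 1)) = xtest := by
    rw [← Fin.succ_last]
    simp only [tokenX, Fin.cons_succ, Fin.snoc_last]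
  have hy : promptWith x y xtest ω (Sum.inr 0) (Fin.last (N + 1)) = 0 := by
    rw [← Fin.succ_last]
    simp only [promptWith, Matrix.of_apply, Sum.elim_inr, Matrix.cons_val_zero, tokenY,
      Fin.cons_succ, Fin.snoc_last]
  rw [readout, predictionBlock, Block.apply, kernelBlock_mlp _ _ _ _ _ hW,
    kernelBlock_attn x y xtest v R _ _ _ ω hv hω hl, hy, if_pos rfl, if_neg (by simp),
    div_self (Real.exp_pos R).ne', one_mul, zero_add, add_zero, kernelSum, hx]
  congr 1
  exact Finset.sum_congr rfl fun j _ => by rw [gaussKernel_comm, mul_comm]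

theorem gradientBlock_iterate (hW : 2 ≤ W) (hv : 0 < v) {lam0 η : ℝ} (h : η * lam0 < 1) (n : ℕ) :
    ∃ ω : Fin (N + 2) → ℝ,
      Transformer.apply (List.replicate n (gradientBlock d N W v R lam0 η)) (prompt x y xtest)
        = promptWith x y xtest ω ∧
      ω 0 = 0 ∧
      (fun i : Fin N => ω i.castSucc.succ) = (dampedStep v lam0 η x y
        (fun i => damping x xtest v R i.castSucc.succ))^[n] 0 := by
  induction n with
  | zero => exact ⟨0, rfl, rfl, rfl⟩
  | succ n ih =>
    obtain ⟨ω, h1, h2, h3⟩ := ih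
    obtain ⟨ω', h4, h5, h6⟩ := gradientBlock_apply x y xtest v R ω hW hv h2 h
    refine ⟨ω', ?_, h5, ?_⟩
    · rw [List.replicate_succ', Transformer.apply, List.foldl_append, ← h4, ← h1]
      rfl
    · rw [Function.iterate_succ_apply', ← h3]
      exact funext h6

/-! ### Size of the damping factors -/

theorem abs_damping_le_one (i : Fin (N + 2)) : |damping x xtest v R i| ≤ 1 := by
  have h1 : 0 ≤ ∑ j : Fin N, gaussKernel v (tokenX x xtest i) (x j) :=
    Finset.sum_nonneg fun j _ => (gaussKernel_pos _ _ _).le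
  have h2 := Real.exp_pos R
  rw [damping, abs_of_nonneg (by positivity), div_le_one (by positivity)]
  linarith

theorem abs_one_sub_damping_le {δ : ℝ} (hδ : N ≤ δ * Real.exp R) (i : Fin (N + 2)) :
    |1 - damping x xtest v R i| ≤ δ := by
  have h1 : 0 ≤ ∑ j : Fin N, gaussKernel v (tokenX x xtest i) (x j) :=
    Finset.sum_nonneg fun j _ => (gaussKernel_pos _ _ _).le
  have h2 : ∑ j : Fin N, gaussKernel v (tokenX x xtest i) (x j) ≤ N := by
    simpa using Finset.sum_le_sum fun (j : Fin N) (_ : j ∈ Finset.univ) =>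
      gaussKernel_le_one v (tokenX x xtest i) (x j)
  have h3 := Real.exp_pos R
  have hδ0 : 0 ≤ δ := nonneg_of_mul_nonneg_left ((Nat.cast_nonneg N).trans hδ) h3
  have h4 : 1 - damping x xtest v R i = (∑ j : Fin N, gaussKernel v (tokenX x xtest i) (x j))
      / (Real.exp R + ∑ j : Fin N, gaussKernel v (tokenX x xtest i) (x j)) := by
    rw [damping]
    field_simp
    ring
  rw [h4, abs_of_nonneg (by positivity), div_le_iff₀ (by positivity)]
  nlinarith [mul_nonneg hδ0 h1]

end

/-! ### Size of the transformer -/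

/-- This is the condition η ≤ 2ρ of the contraction estimate with ρ = 1 - ηλ₀. -/
theorem eta_mul_le_two {lam0 kmin η : ℝ} (hlam0 : 0 < lam0) (hkmin0 : 0 < kmin)
    (hkmin1 : kmin ≤ 1) (hη0 : 0 < η) (hη : η ≤ 2 / (1 + lam0 + lam0 / kmin)) :
    η * (1 + 2 * lam0) ≤ 2 := by
  rw [le_div_iff₀ (by positivity)] at hη
  have h : lam0 ≤ lam0 / kmin := le_div_self hlam0.le hkmin0 hkmin1
  nlinarith

theorem natCeil_le_add_one_mul {a b s : ℝ} (ha : 0 ≤ a) (hs : 1 ≤ s) (h : b ≤ a * s) :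
    (⌈b⌉₊ : ℝ) ≤ (a + 1) * s := by
  have h1 : ⌈b⌉₊ ≤ ⌈a * s⌉₊ := Nat.ceil_mono h
  have h2 : (⌈a * s⌉₊ : ℝ) < a * s + 1 := Nat.ceil_lt_add_one (by positivity)
  have h3 : (⌈b⌉₊ : ℝ) ≤ ⌈a * s⌉₊ := by exact_mod_cast h1
  linarith

theorem log_inv_rate_pos {c lam0 η : ℝ} (hc1 : c < 1) (hlam0 : 0 < lam0) (hη0 : 0 < η)
    (hη2 : η * (1 + 2 * lam0) ≤ 2) (hc0 : 0 < c) :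
    0 < Real.log (1 / (1 - η * lam0 * (1 - c))) := by
  have h1 : 0 < η * lam0 := by positivity
  refine Real.log_pos ?_
  rw [lt_div_iff₀ (by nlinarith)]
  nlinarith

theorem exists_numIter_le {c lam0 η : ℝ} (hc0 : 0 < c) (hc1 : c < 1) (hlam0 : 0 < lam0)
    (hη0 : 0 < η) (hη2 : η * (1 + 2 * lam0) ≤ 2) :
    ∃ C : ℝ, ∀ ε : ℝ, 0 < ε → ε < c → (numIter c lam0 η ε : ℝ) ≤ C * Real.log (1 / ε) := by
  have hq := log_inv_rate_pos hc1 hlam0 hη0 hη2 hc0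
  set q := Real.log (1 / (1 - η * lam0 * (1 - c))) with hqdef
  have hlc : 0 < Real.log (1 / c) := Real.log_pos (by rw [lt_div_iff₀ hc0]; linarith)
  -- The second summand pays for rounding up: ε < c keeps log(1/ε) above log(1/c) > 0.
  refine ⟨1 / q + 1 / Real.log (1 / c), fun ε hε0 hε => ?_⟩
  have h1 : Real.log (1 / c) ≤ Real.log (1 / ε) :=
    Real.log_le_log (by positivity) (one_div_le_one_div_of_le hε0 hε.le)
  have h2 : (numIter c lam0 η ε : ℝ) < Real.log (1 / ε) / q + 1 :=
    Nat.ceil_lt_add_one (div_nonneg (hlc.le.trans h1) hq.le)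
  have h3 : 1 ≤ 1 / Real.log (1 / c) * Real.log (1 / ε) := by
    rw [one_div, inv_mul_eq_div, le_div_iff₀ hlc]
    linarith
  rw [add_mul, one_div, inv_mul_eq_div]
  linarith

theorem rate_pow_numIter_le {c lam0 η ε : ℝ} (hc0 : 0 < c) (hc1 : c < 1) (hlam0 : 0 < lam0)
    (hη0 : 0 < η) (hη2 : η * (1 + 2 * lam0) ≤ 2) (hε0 : 0 < ε) :
    (1 - η * lam0 * (1 - c)) ^ numIter c lam0 η ε ≤ ε := by
  have hq := log_inv_rate_pos hc1 hlam0 hη0 hη2 hc0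
  have h1 : 0 < η * lam0 := by positivity
  have h2 : 0 < 1 - η * lam0 * (1 - c) := by nlinarith
  have h3 : Real.log (1 / ε) / Real.log (1 / (1 - η * lam0 * (1 - c)))
      ≤ numIter c lam0 η ε := Nat.le_ceil _
  rw [div_le_iff₀ hq, one_div, one_div, Real.log_inv, Real.log_inv] at h3
  rw [← Real.log_le_log_iff (by positivity) hε0, Real.log_pow]
  linarith

theorem Balpha_eq {kmin : ℝ} (N : ℕ) : Balpha kmin N = (1 / kmin + 1) / N := by
  rw [Balpha, ← div_div, div_right_comm, ← add_div]

theorem exists_Bw_le {c lam0 By kmin : ℝ} (hc1 : c < 1) (hlam0 : 0 < lam0) (hBy : 0 ≤ By)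
    (hkmin0 : 0 < kmin) :
    ∃ b : ℝ, 0 ≤ b ∧ ∀ N : ℕ, 1 ≤ N → Bw c lam0 By kmin N ≤ b / √N := by
  have hc : 0 < 1 - c := by linarith
  set b₁ := (1 / √lam0 + 1) * By / (lam0 * √kmin)
      + (By / √lam0 + 2 * (1 + lam0)) / (lam0 * (1 - c) * √kmin) with hb₁
  set b₂ := (1 / √lam0 + 1) * By / lam0 with hb₂
  have h₂ : 0 ≤ b₂ := by positivity
  refine ⟨b₁ + b₂, by positivity, fun N hN => ?_⟩
  have hN' : (1 : ℝ) ≤ N := by exact_mod_cast hN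
  have h : 1 / (N : ℝ) ≤ 1 / √N :=
    one_div_le_one_div_of_le (by positivity) (Real.sqrt_le_self_iff.2 (Or.inr hN'))
  calc Bw c lam0 By kmin N = 1 / √N * b₁ + 1 / N * b₂ := rfl
    _ ≤ 1 / √N * b₁ + 1 / √N * b₂ := by gcongr
    _ = (b₁ + b₂) / √N := by ring

/-- Every width is compared with s = √(N/ε), which is at least 1 and so absorbs roundings and
additive constants. -/
theorem exists_width_le {c lam0 By kmin : ℝ} (hc1 : c < 1) (hlam0 : 0 < lam0) (hBy : 0 ≤ By)
    (hkmin0 : 0 < kmin) :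
    ∃ C : ℝ, ∀ (N : ℕ) (ε : ℝ), 1 ≤ N → 0 < ε → ε < c →
      (width c lam0 By kmin N ε : ℝ) ≤ C * √(N / ε) := by
  obtain ⟨b, hb0, hb⟩ := exists_Bw_le hc1 hlam0 hBy hkmin0
  set A := 1 / kmin + 1 with hA
  have hA0 : 0 ≤ A := by positivity
  -- The value at N = 1, where the `nFlip` coefficient is largest.
  set F := 2 * (1 / √(1 - 1 / (1 + kmin)) - 1) with hF
  set C := |F| + (By + A) + (b + A) + 6 + (b + 3) with hC
  refine ⟨2 * (C + 1) + 4, fun N ε hN hε0 hε => ?_⟩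
  have hN' : (1 : ℝ) ≤ N := by exact_mod_cast hN
  have hN0 : (0 : ℝ) < N := by linarith
  set s := √(N / ε) with hs
  have hs1 : 1 ≤ s := by
    rw [hs, Real.one_le_sqrt, le_div_iff₀ hε0]
    linarith
  have hsqrtN : 1 ≤ √(N : ℝ) := Real.one_le_sqrt.2 hN'
  have hinv : ∀ a : ℝ, a / √(ε / N) = a * s := fun a => by
    rw [hs, ← inv_div (N : ℝ), Real.sqrt_inv, div_inv_eq_mul]
  have hF0 := abs_nonneg F
  have hFC : |F| ≤ C := by rw [hC]; linarith
  have hC0 : 0 ≤ C := hF0.trans hFC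
  have hBa : Balpha kmin N ≤ A / √N := by
    rw [Balpha_eq]
    exact div_le_div_of_nonneg_left hA0 (by positivity) (Real.sqrt_le_self_iff.2 (Or.inr hN'))
  have hA1 : A / √N ≤ A := div_le_self hA0 hsqrtN
  have hb1 : b / √N ≤ b := div_le_self hb0 hsqrtN
  have key : ∀ z : ℝ, z ≤ C * s → (⌈z⌉₊ : ℝ) ≤ (C + 1) * s := fun z hz =>
    natCeil_le_add_one_mul hC0 hs1 hz
  have h1 : (nFlip kmin N ε : ℝ) ≤ (C + 1) * s := by
    refine key _ ?_
    rw [hinv]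
    gcongr
    refine le_trans ?_ ((le_abs_self F).trans hFC)
    rw [hF]
    have h : kmin ≤ N * kmin := by nlinarith
    have h' : 0 < 1 - 1 / (1 + kmin) := by
      rw [sub_pos, div_lt_one (by positivity)]
      linarith
    gcongr
  have h2 : (nSq By kmin N ε : ℝ) ≤ (C + 1) * s := by
    refine key _ ?_
    rw [hinv]
    gcongr
    linarith
  have h3 : (nSqTilde c lam0 By kmin N ε : ℝ) ≤ (C + 1) * s := by
    refine key _ ?_
    -- The extra √N coming from ε/N² is compensated by the 1/√N decay of `Bw` and `Balpha`.
    have h : √(ε / N ^ 2) = √(ε / N) / √N := by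
      rw [← Real.sqrt_div' _ hN0.le, div_div, sq]
    rw [h, div_div_eq_mul_div, hinv]
    gcongr
    calc (Bw c lam0 By kmin N + Balpha kmin N) * √N ≤ (b / √N + A / √N) * √N := by
          gcongr
          exact hb N hN
      _ = b + A := by field_simp
      _ ≤ C := by linarith
  have h4 : (nInv N ε : ℝ) ≤ (C + 1) * s := by
    refine key _ ?_
    have h : √((N + 1) / ε) ≤ 2 * s := by
      rw [Real.sqrt_le_left (by positivity), mul_pow, hs, Real.sq_sqrt (by positivity),
        ← mul_div_assoc]
      gcongr
      linarith
    nlinarith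
  have h5 : (nSqHat c lam0 By kmin N ε : ℝ) ≤ (C + 1) * s := by
    refine key _ ?_
    rw [hinv]
    gcongr
    linarith [hb N hN]
  have hpos : 0 ≤ (C + 1) * s := by positivity
  have hsplit : (2 * (C + 1) + 4) * s = 2 * ((C + 1) * s) + 4 * s := by ring
  simp only [width, Nat.cast_max, Nat.cast_mul, Nat.cast_add, Nat.cast_ofNat, max_le_iff]
  refine ⟨?_, ?_, ?_, ?_, ?_, ?_⟩ <;> linarith

theorem two_le_width (c lam0 By kmin : ℝ) (N : ℕ) (ε : ℝ) : 2 ≤ width c lam0 By kmin N ε := by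
  simp [width]

/-- The left side is the error constant actually achieved; the first summand of `Csys` already
dominates it because 2/√κ + 1 ≥ 3. -/
theorem three_mul_le_Csys {c lam0 By kmin : ℝ} (hc1 : c < 1) (hlam0 : 0 < lam0) (hBy : 0 ≤ By)
    (hkmin0 : 0 < kmin) (hkmin1 : kmin ≤ 1) : 3 * (By / lam0) ≤ Csys c lam0 By kmin := by
  have hc : 0 < 1 - c := by linarith
  have h1 : 2 ≤ 2 / √kmin := by
    rw [le_div_iff₀ (by positivity)]
    nlinarith [Real.sqrt_le_one.2 hkmin1]
  have h2 : By / lam0 ≤ (1 / √lam0 + 1) * By / lam0 := by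
    gcongr
    have : 0 ≤ 1 / √lam0 := by positivity
    nlinarith
  have h3 : By / lam0 * 3 ≤ (1 / √lam0 + 1) * By / lam0 * (2 / √kmin + 1) := by
    gcongr
    linarith
  have h4 : 0 ≤ 2 * ((By / √lam0 + 2 * (1 + lam0)) / (lam0 * (1 - c) * √kmin)) := by positivity
  rw [Csys]
  linarith

end KernelICL

/-! ### Assembly of the transformer and the final error bound -/

theorem mainTheorem1 (c lam0 By kmin : ℝ) (hc0 : 0 < c) (hc1 : c < 1) (hlam0 : 0 < lam0)
    (hBy : 0 ≤ By) (hkmin0 : 0 < kmin) (hkmin1 : kmin ≤ 1) :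
    (∃ C : ℝ, ∀ (N : ℕ) (ε : ℝ), 1 ≤ N → 0 < ε → ε < c →
      (width c lam0 By kmin N ε : ℝ) ≤ C * √(N / ε)) ∧
    ∀ η : ℝ, 0 < η → η ≤ 2 / (1 + lam0 + lam0 / kmin) →
      (∃ C : ℝ, ∀ ε : ℝ, 0 < ε → ε < c →
        (numIter c lam0 η ε : ℝ) ≤ C * Real.log (1 / ε)) ∧
      ∀ (d N : ℕ) (v ε : ℝ), 1 ≤ N → 0 < v → 0 < ε → ε < c →
        ∃ TF : Transformer (Feature d) (Fin (N + 2)) (width c lam0 By kmin N ε),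
          TF.length = 2 * numIter c lam0 η ε + 5 ∧
          ∀ (x : Fin N → EuclideanSpace ℝ (Fin d)) (y : Fin N → ℝ)
            (xtest : EuclideanSpace ℝ (Fin d)),
            (∀ i, |y i| ≤ By) →
            (∀ i j, kmin ≤ gaussKernel v (x i) (x j)) →
            (∀ i, kmin ≤ gaussKernel v (x i) xtest) →
            ∃ w : Fin N → ℝ, IsKRRSolution v lam0 x y w ∧
              (∀ w' : Fin N → ℝ, IsKRRSolution v lam0 x y w' → w' = w) ∧
              |readout (Transformer.apply TF (prompt x y xtest))
                  - ∑ i, w i * gaussKernel v (x i) xtest| ≤ Csys c lam0 By kmin * ε := by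
  refine ⟨exists_width_le hc1 hlam0 hBy hkmin0, fun η hη0 hη => ?_⟩
  have hη2 := eta_mul_le_two hlam0 hkmin0 hkmin1 hη0 hη
  refine ⟨exists_numIter_le hc0 hc1 hlam0 hη0 hη2, fun d N v ε hN hv hε0 hε => ?_⟩
  have hN' : (1 : ℝ) ≤ N := by exact_mod_cast hN
  have hc : 0 < 1 - c := by linarith
  have hW := two_le_width c lam0 By kmin N ε
  have hηlam : 0 < η * lam0 := by positivity
  have hηlam1 : η * lam0 < 1 := by linarith
  -- The three bounds on δ control, in turn, the damping at readout, the loss of rate from 1 - ηλ₀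
  -- to 1 - ηλ₀(1-c), and the stationary error, which becomes τ = ε.
  obtain ⟨δ, hδ0, hδ1, hδ2, hδ3⟩ : ∃ δ : ℝ, 0 < δ ∧ δ ≤ ε ∧ δ ≤ lam0 * c ∧
      δ ≤ ε * (lam0 * (1 - c)) :=
    ⟨min ε (min (lam0 * c) (ε * (lam0 * (1 - c)))), by positivity, min_le_left _ _,
      (min_le_right _ _).trans (min_le_left _ _), (min_le_right _ _).trans (min_le_right _ _)⟩
  set R := Real.log (N / δ) with hR
  have hRδ : (N : ℝ) ≤ δ * Real.exp R := by
    rw [hR, Real.exp_log (by positivity), mul_div_cancel₀ _ hδ0.ne']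
  set L := numIter c lam0 η ε with hL
  -- L steps already reach accuracy ε; the further ones fill the prescribed depth, and q ≤ 1 makes
  -- them harmless.
  refine ⟨List.replicate (2 * L + 4) (gradientBlock d N _ v R lam0 η)
    ++ [predictionBlock d N _ v R], by simp, fun x y xtest hy _ _ => ?_⟩
  obtain ⟨w, hw, huniq⟩ := existsUnique_isKRRSolution hN v hlam0 x y
  refine ⟨w, hw, huniq, ?_⟩
  obtain ⟨ω, h1, h2, h3⟩ := gradientBlock_iterate x y xtest v R hW hv hηlam1 (2 * L + 4)
  have hout : Transformer.apply (List.replicate (2 * L + 4) (gradientBlock d N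
      (width c lam0 By kmin N ε) v R lam0 η) ++ [predictionBlock d N _ v R]) (prompt x y xtest)
      = (predictionBlock d N (width c lam0 By kmin N ε) v R).apply (promptWith x y xtest ω) := by
    rw [← h1, Transformer.apply, List.foldl_append]
    rfl
  rw [hout, readout_predictionBlock_apply x y xtest v R ω hW hv h2]
  have hθ := abs_one_sub_damping_le x xtest v R hRδ
  set θ := damping x xtest v R (Fin.last (N + 1))
  set q := 1 - η * lam0 * (1 - c) with hq
  have hq0 : 0 ≤ q := by nlinarith
  have hq1 : q ≤ 1 := by nlinarith
  have herr := l2norm_iterate_dampedStep_sub_le hN hη0.le hη2 hδ0.le hw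
    (fun i => hθ i.castSucc.succ) hq0 (q := q) (τ := ε)
    (by rw [hq]; nlinarith [mul_le_mul_of_nonneg_left hδ2 hη0.le]) hε0.le
    (by rw [hq]; nlinarith [mul_le_mul_of_nonneg_left hδ3 hη0.le]) (2 * L + 4)
  rw [← h3] at herr
  set u : Fin N → ℝ := fun i => ω i.castSucc.succ with hu
  have hpow : q ^ (2 * L + 4) ≤ ε :=
    (pow_le_pow_of_le_one hq0 hq1 (by omega)).trans
      (rate_pow_numIter_le hc0 hc1 hlam0 hη0 hη2 hε0)
  have hwn := hw.sqrt_mul_l2norm_le hN hlam0 hBy hy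
  have hw0 := l2norm_nonneg w
  have hκ0 : ∀ i, 0 ≤ gaussKernel v (x i) xtest := fun i => (gaussKernel_pos _ _ _).le
  have hκ1 : ∀ i, gaussKernel v (x i) xtest ≤ 1 := fun i => gaussKernel_le_one _ _ _
  have hbound : ∀ e : Fin N → ℝ, ∀ a : ℝ, 0 ≤ a → l2norm e ≤ a * l2norm w →
      |∑ i, e i * gaussKernel v (x i) xtest| ≤ a * (By / lam0) := fun e a ha he =>
    calc _ ≤ √N * l2norm e := abs_sum_mul_le e _ hκ0 hκ1
      _ ≤ √N * (a * l2norm w) := by gcongr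
      _ = a * (√N * l2norm w) := by ring
      _ ≤ _ := by gcongr
  have hB : 0 ≤ By / lam0 := by positivity
  have e1 := hbound (u - w) (ε + ε) (by positivity)
    (herr.trans (by gcongr))
  have e2 := hbound w 1 zero_le_one (by rw [one_mul])
  have hθ1 : |θ| ≤ 1 := abs_damping_le_one x xtest v R _
  -- The error splits into the iterate error, of weight 2ε from q^n ≤ ε and τ = ε, and the damping
  -- error at readout, of weight δ ≤ ε.
  have hsub : θ * ∑ j, ω j.castSucc.succ * gaussKernel v (x j) xtest
      - ∑ i, w i * gaussKernel v (x i) xtest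
      = θ * ∑ i, (u - w) i * gaussKernel v (x i) xtest
        - (1 - θ) * ∑ i, w i * gaussKernel v (x i) xtest := by
    simp only [hu, Pi.sub_apply, sub_mul, Finset.sum_sub_distrib]
    ring
  rw [hsub]
  calc _ ≤ |θ| * |∑ i, (u - w) i * gaussKernel v (x i) xtest|
        + |1 - θ| * |∑ i, w i * gaussKernel v (x i) xtest| := by
        rw [← abs_mul, ← abs_mul]
        exact abs_sub _ _
    _ ≤ 1 * ((ε + ε) * (By / lam0)) + ε * (1 * (By / lam0)) := by
        gcongr
        exact (hθ _).trans hδ1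
    _ = 3 * (By / lam0) * ε := by ring
    _ ≤ _ := by
        gcongr
        exact three_mul_le_Csys hc1 hlam0 hBy hkmin0 hkmin1
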